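/- \textbf{Setting.} Let $\mathsf X\subset\mathbb R^{m}$ be compact with its Borel $\sigma$-algebra and a finite measure $\rho$. Let $A,B_0:\mathsf X\to\mathbb R$ and $B:\mathsf X\times\mathsf X\to\mathbb R$ be bounded measurable functions with $B(x,y)=B(y,x)$ and $B(x,x)=B_0(x)$. Let $\mathcal S$ be a countably infinite, linearly ordered set. Let $\mathcal M$ be the set of symmetric matrices $\theta:\mathcal S\times\mathcal S\to\mathbb R$ with $\sum_{\ell\ne s}|\theta(s,\ell)|<\infty$ for every $s$, and let $\mathcal M_1$ be the Banach space of symmetric matrices with $\|\theta\|_1=\sum_{s\preceq\ell}|\theta(s,\ell)|<\infty$. For $s\in T\subseteq\mathcal S$, and for $\theta\in\mathcal M$ (or $T$ finite and $\theta$ symmetric), put \[ f^{(s)}_\theta(u\mid x_{T\setminus\{s\}})=\frac1Z\exp\Big\{A(u)+\theta(s,s)B_0(u)+\sum_{\ell\in T\setminus\{s\}}\theta(s,\ell)B(u,x_\ell)\Big\},\qquad u\in\mathsf X, \] where $Z=Z(\theta,s,x_{T\setminus\{s\}})$ makes this a probability density with respect to $\rho$. A law $\mu$ on $\mathsf X^{\mathcal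 S}$ is an auto-model law with network $\theta$ if, for every $s$, the conditional distribution under $\mu$ of $X_s$ given $X_{\mathcal S\setminus\{s\}}$ has $\rho$-density $f^{(s)}_\theta(\cdot\mid X_{\mathcal S\setminus\{s\}})$. Let $\theta_\star\in\mathcal M$ be such that $\{\ell\neq s:\theta_\star(s,\ell)\ne0\}$ is finite for every $s$, let $\mu_\star$ be an auto-model law with network $\theta_\star$, and let $X^{(1)},X^{(2)},\dots$ be i.i.d. with law $\mu_\star$ on a probability space. Let $D_1\subseteq D_2\subseteq\cdots$ be finite subsets of $\mathcal S$ with union $\mathcal S$. Let $\theta_\star^{(n)}$ be the matrix equal to $\theta_\star$ on $D_n\times D_n$ and to $0$ elsewhere, and let $\mathcal M^{(n)}\subset\mathcal M_1$ be the space of symmetric matrices vanishing outside $D_n\times D_n$. For $\lambda\ge0$ let $q_\lambda:[0,\infty)\to[0,\infty)$ satisfy $q_\lambda(0)=0$, be right-continuous at $0$ and differentiable on $(0,\infty)$, with $\sup_{\lambda>0}\sup_{x>0}|q_\lambda'(x)|/\lambda<\infty$. Let $\lambda_n>0$ with $\lambda_n/n\to0$. For $\theta\in\mathcal M^{(n)}$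 let \[ Q_n(\theta)=\sum_{i=1}^n\sum_{s\in D_n}\log f^{(s)}_\theta\big(X^{(i)}_s\mid X^{(i)}_{D_n\setminus\{s\}}\big)-\sum_{s,\ell\in D_n,\ s\preceq\ell}q_{\lambda_n}(|\theta(s,\ell)|), \] and let $\operatorname{Argmax}Q_n$ be its set of maximizers over $\mathcal M^{(n)}$. For $\theta\in\mathcal M$ and $s\in\mathcal S$ let \[ \rho_\theta^{(s)}(\ell,\ell')=\mathbb E_{\mu_\star}\Big[\operatorname{Cov}_\theta\big(B(X_s,X_\ell),B(X_s,X_{\ell'})\mid X_{\mathcal S\setminus\{s\}}\big)\Big],\qquad \ell,\ell'\in\mathcal S, \] where the covariance is taken with $X_{\mathcal S\setminus\{s\}}$ fixed and $X_s$ drawn from the density $f_\theta^{(s)}(\cdot\mid X_{\mathcal S\setminus\{s\}})$. \textbf{Corollary.} Suppose that for every $\theta\in\mathcal M$ and every $s\in\mathcal S$ the infinite matrix $\rho_\theta^{(s)}$ is positive definite, i.e. $\sum_{\ell,\ell'}a_\ell a_{\ell'}\rho^{(s)}_\theta(\ell,\ell')>0$ for every nonzero finitely supported $a:\mathcal S\to\mathbb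 R$. Let $(\hat\theta_n)_{n\ge1}$ be a sequence of Borel measurable random elements of $\mathcal M_1$ with $\hat\theta_n\in\operatorname{Argmax}Q_n$ almost surely for all $n\ge1$. If the sequence $(\hat\theta_n-\theta_\star^{(n)})_{n\ge1}$ is uniformly tight in $\mathcal M_1$, then $\|\hat\theta_n-\theta_\star^{(n)}\|_1\to0$ in probability. -/

import Mathlib

open MeasureTheory ProbabilityTheory Filter Topology

/-- The known ingredients of an auto-model on the sample space `E`: a finite reference measure `ρ`,
bounded measurable functions `A`, `B₀` on `E` and a bounded measurable symmetric function `B` on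
`E × E` whose diagonal is `B₀`. -/
structure AutoModelData (E : Type*) [MeasurableSpace E] where
  ρ : Measure E
  finite_ρ : IsFiniteMeasure ρ
  A : E → ℝ
  B₀ : E → ℝ
  B : E → E → ℝ
  measurable_A : Measurable A
  measurable_B₀ : Measurable B₀
  measurable_B : Measurable (Function.uncurry B)
  symm_B : ∀ x y, B x y = B y x
  diag_B : ∀ x, B x x = B₀ x
  bounded_A : ∃ C : ℝ, ∀ x, |A x| ≤ C
  bounded_B₀ : ∃ C : ℝ, ∀ x, |B₀ x| ≤ C
  bounded_B : ∃ C : ℝ, ∀ x y, |B x y| ≤ C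

/-- The space `𝓜` of infinite symmetric matrices `θ` with finite degrees
`deg(s, θ) = ∑_{ℓ ≠ s} |θ(s, ℓ)| < ∞`. -/
def NetworkMatrices (S : Type*) : Set (S → S → ℝ) :=
  {θ | (∀ s ℓ, θ s ℓ = θ ℓ s) ∧ ∀ s, Summable fun ℓ : ({s}ᶜ : Set S) => |θ s ℓ|}

/-- The Banach space `𝓜₁` of infinite symmetric matrices with
`‖θ‖₁ = ∑_{s ≤ ℓ} |θ(s, ℓ)| < ∞`. A symmetric matrix is recorded by its entries at the ordered
pairs `(s, ℓ)`, `s ≤ ℓ`; the full matrix is recovered by `M1.toMatrix`. -/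
abbrev M1 (S : Type*) [LinearOrder S] : Type _ :=
  lp (fun _ : {p : S × S // p.1 ≤ p.2} => ℝ) 1

namespace M1

variable {S : Type*} [LinearOrder S]

/-- The infinite symmetric matrix described by an element of `𝓜₁`. -/
def toMatrix (θ : M1 S) : S → S → ℝ :=
  fun s ℓ => θ ⟨(min s ℓ, max s ℓ), min_le_max⟩

/-- The space of symmetric matrices indexed by `D × D`, for a finite set `D` of nodes, seen inside
`𝓜₁` (entries outside `D × D` are zero). -/
def supportedOn (D : Finset S) : Set (M1 S) :=
  {θ | ∀ p : {p : S × S // p.1 ≤ p.2}, ¬ (p.1.1 ∈ D ∧ p.1.2 ∈ D) → θ p = 0}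

lemma memℓp_truncation (D : Finset S) (θ : S → S → ℝ) :
    Memℓp (fun p : {p : S × S // p.1 ≤ p.2} =>
      if p.1.1 ∈ D ∧ p.1.2 ∈ D then θ p.1.1 p.1.2 else (0 : ℝ)) 1 := by
  refine memℓp_gen (summable_of_hasFiniteSupport ?_)
  have hfin : Set.Finite {p : {p : S × S // p.1 ≤ p.2} | p.1 ∈ D ×ˢ D} :=
    Set.Finite.preimage Subtype.val_injective.injOn (D ×ˢ D).finite_toSet
  refine hfin.subset fun p hp => ?_
  by_contra h
  simp only [Set.mem_ofPred_eq, Finset.mem_product] at h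
  simp [h] at hp

/-- The restriction of an infinite symmetric matrix `θ` to `D × D`, extended by zero. -/
def truncation (D : Finset S) (θ : S → S → ℝ) : M1 S :=
  ⟨fun p => if p.1.1 ∈ D ∧ p.1.2 ∈ D then θ p.1.1 p.1.2 else 0, memℓp_truncation D θ⟩

end M1

namespace AutoModelData

variable {E : Type*} [MeasurableSpace E] (𝓐 : AutoModelData E) {S : Type*}

/-- The exponent `A(u) + θ(s, s) B₀(u) + ∑_{ℓ ∈ T, ℓ ≠ s} θ(s, ℓ) B(u, x_ℓ)`. -/
noncomputable def energy (θ : S → S → ℝ) (T : Set S) (s : S) (x : S → E) (u : E) : ℝ :=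
  𝓐.A u + θ s s * 𝓐.B₀ u + ∑' ℓ : (T \ {s} : Set S), θ s ℓ * 𝓐.B u (x ℓ)

/-- The conditional density `f_θ^{(s)}(u | x_{T ∖ {s}})` with respect to `ρ`. The full conditional
density is obtained for `T = univ`, and the approximate one, based on the observed nodes only, for
`T = D_n`. It does not depend on `x s`. -/
noncomputable def condDensity (θ : S → S → ℝ) (T : Set S) (s : S) (x : S → E) (u : E) : ℝ :=
  Real.exp (𝓐.energy θ T s x u) / ∫ v, Real.exp (𝓐.energy θ T s x v) ∂𝓐.ρ

/-- The full conditional law of the value at `s`, given the values `x` at the other nodes. -/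
noncomputable def condLaw (θ : S → S → ℝ) (s : S) (x : S → E) : Measure E :=
  𝓐.ρ.withDensity fun u => ENNReal.ofReal (𝓐.condDensity θ Set.univ s x u)

/-- `μ` is the law of an infinite-volume auto-model random field with network `θ`: for every node
`s`, under `μ`, the conditional distribution of `X_s` given the sigma-algebra generated by
`{X_ℓ, ℓ ≠ s}` has density `f_θ^{(s)}(· | X_{S ∖ {s}})` with respect to `ρ`. -/
def IsAutoModelLaw (θ : S → S → ℝ) (μ : Measure (S → E)) : Prop :=
  IsProbabilityMeasure μ ∧
  ∀ s : S, ∀ F : Set E, MeasurableSet F →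
    μ[((fun x : S → E => x s) ⁻¹' F).indicator (fun _ => (1 : ℝ)) | cylinderEvents {s}ᶜ]
      =ᵐ[μ] fun x => (𝓐.condLaw θ s x).real F

variable [LinearOrder S]

/-- The penalized log-pseudo-likelihood `Q_n(θ)` of the sample `x 0, …, x (n - 1)`, based on the
nodes in `D`, with penalty function `pen = q_{λ_n}`. -/
noncomputable def penPseudoLik (D : Finset S) (pen : ℝ → ℝ) (n : ℕ) (x : ℕ → S → E)
    (θ : S → S → ℝ) : ℝ :=
  (∑ i ∈ Finset.range n, ∑ s ∈ D, Real.log (𝓐.condDensity θ D s (x i) (x i s))) -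
    ∑ p ∈ (D ×ˢ D).filter (fun p => p.1 ≤ p.2), pen |θ p.1 p.2|

/-- `Argmax Q_n`, the set of penalized pseudo-likelihood estimators. -/
def argmaxPenPseudoLik (D : Finset S) (pen : ℝ → ℝ) (n : ℕ) (x : ℕ → S → E) : Set (M1 S) :=
  {θ | θ ∈ M1.supportedOn D ∧
    IsMaxOn (fun ϑ : M1 S => 𝓐.penPseudoLik D pen n x ϑ.toMatrix) (M1.supportedOn D) θ}

/-- The infinite matrix
`ρ_θ^{(s)}(ℓ, ℓ') = 𝔼_μ[Cov_θ(B(X_s, X_ℓ), B(X_s, X_ℓ') | X_{S ∖ {s}})]`: the conditional covariance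
is taken under the full conditional law of `X_s` with network `θ`, the other coordinates being
fixed, and the outer expectation is under `μ`. -/
noncomputable def condCovMatrix (θ : S → S → ℝ) (s : S) (μ : Measure (S → E)) : Matrix S S ℝ :=
  Matrix.of fun ℓ ℓ' => ∫ x, covariance
    (fun u => 𝓐.B u (Function.update x s u ℓ)) (fun u => 𝓐.B u (Function.update x s u ℓ'))
    (𝓐.condLaw θ s x) ∂μ

end AutoModelData

/-- The assumptions on the family of penalty functions `q_λ : [0, ∞) → [0, ∞)`, `λ ≥ 0`; only the
values `q lam x` with `lam, x ≥ 0` matter. -/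
structure IsPenaltyFamily (q : ℝ → ℝ → ℝ) : Prop where
  nonneg : ∀ lam, 0 ≤ lam → ∀ x, 0 ≤ x → 0 ≤ q lam x
  zero : ∀ lam, 0 ≤ lam → q lam 0 = 0
  rightCont : ∀ lam, 0 ≤ lam → ContinuousWithinAt (q lam) (Set.Ici 0) 0
  diff : ∀ lam, 0 ≤ lam → DifferentiableOn ℝ (q lam) (Set.Ioi 0)
  deriv_bound : ∃ C : ℝ, ∀ lam, 0 < lam → ∀ x, 0 < x → |deriv (q lam) x| / lam ≤ C

/-! This is a Wald-type consistency argument: compactness comes from tightness, and identifiability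
from positive definiteness. Write the estimator as the truncated truth plus a perturbation `w`. For
a fixed `v ≠ 0`, the expected change of the conditional log-likelihood at each node is minus a
Kullback-Leibler divergence. It is therefore nonpositive, and it is strictly negative at a node
whose row of `v` is nonzero (`integral_contrast_neg`).

Log-densities are Lipschitz in the `ℓ¹` norm of the row, uniformly in the sample. Hence all but
finitely many nodes, and the passage from `v` to a nearby `w`, cost at most a small multiple of `n`.
The penalty costs `O(lam n) = o(n)`. On the finitely many remaining nodes the neighbourhoods
eventually lie in `D n`, so the truncated densities are the true ones and the law of large numbers
applies. Almost surely, then, a whole ball around `v` is eventually free of maximizers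
(`exists_ball_penPseudoLik_lt`). A compact set carrying most of the mass, minus a neighbourhood of
zero, is covered by finitely many such balls (`tendstoInMeasure_norm_of_isTightMeasureSet`).

The delicate point is identifiability for infinite rows, since positive definiteness only tests
finitely supported vectors. `not_ae_tsum_eq` settles it by resampling single coordinates from their
positive conditional densities. -/

namespace AutoModelData

/-! ### Normalized exponentials -/

section Gibbs

variable {E : Type*} [MeasurableSpace E] {ρ : Measure E}

lemma integrable_exp_of_bounded [IsFiniteMeasure ρ] {f : E → ℝ} (hf : Measurable f) {M : ℝ}
    (hM : ∀ u, |f u| ≤ M) : Integrable (fun u => Real.exp (f u)) ρ := by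
  refine Integrable.of_bound (C := Real.exp M) hf.exp.aestronglyMeasurable
    (Eventually.of_forall fun u => ?_)
  rw [Real.norm_eq_abs, Real.abs_exp]
  exact Real.exp_le_exp.2 ((le_abs_self _).trans (hM u))

lemma integral_exp_pos_of_bounded [IsFiniteMeasure ρ] [NeZero ρ] {f : E → ℝ} (hf : Measurable f)
    {M : ℝ} (hM : ∀ u, |f u| ≤ M) : 0 < ∫ u, Real.exp (f u) ∂ρ :=
  integral_exp_pos (integrable_exp_of_bounded hf hM)

/-- The logarithm of a normalized exponential is Lipschitz in the exponent. -/
lemma abs_log_normalized_exp_sub_le [IsFiniteMeasure ρ] [NeZero ρ] {f g : E → ℝ}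
    (hf : Measurable f) (hg : Measurable g) {M N δ : ℝ} (hM : ∀ u, |f u| ≤ M)
    (hN : ∀ u, |g u| ≤ N) (h : ∀ u, |f u - g u| ≤ δ) (u : E) :
    |Real.log (Real.exp (f u) / ∫ v, Real.exp (f v) ∂ρ)
      - Real.log (Real.exp (g u) / ∫ v, Real.exp (g v) ∂ρ)| ≤ 2 * δ := by
  -- The exponent and the log-normalizer each move by at most `δ`, whence the factor 2. The
  -- one-sided bound for the normalizer is applied in both directions.
  have key : ∀ {f g : E → ℝ}, Measurable f → Measurable g → (∃ M, ∀ u, |f u| ≤ M) →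
      (∃ N, ∀ u, |g u| ≤ N) → (∀ u, |f u - g u| ≤ δ) →
      Real.log (∫ v, Real.exp (f v) ∂ρ) ≤ Real.log (∫ v, Real.exp (g v) ∂ρ) + δ := by
    rintro f g hf hg ⟨M, hM⟩ ⟨N, hN⟩ h
    have hgp := integral_exp_pos_of_bounded (ρ := ρ) hg hN
    rw [← Real.log_exp δ, ← Real.log_mul hgp.ne' (Real.exp_pos _).ne']
    refine Real.log_le_log (integral_exp_pos_of_bounded hf hM) ?_
    rw [← integral_mul_const]
    refine integral_mono (integrable_exp_of_bounded hf hM)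
      ((integrable_exp_of_bounded hg hN).mul_const _) fun v => ?_
    simp only [← Real.exp_add]
    have := (abs_le.1 (h v)).2
    exact Real.exp_le_exp.2 (by linarith)
  have h1 := key hf hg ⟨M, hM⟩ ⟨N, hN⟩ h
  have h2 := key hg hf ⟨N, hN⟩ ⟨M, hM⟩ fun u => by rw [abs_sub_comm]; exact h u
  have h3 := abs_le.1 (h u)
  rw [Real.log_div (Real.exp_pos _).ne' (integral_exp_pos_of_bounded hf hM).ne',
    Real.log_div (Real.exp_pos _).ne' (integral_exp_pos_of_bounded hg hN).ne',
    Real.log_exp, Real.log_exp, abs_le]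
  constructor <;> linarith [h3.1, h3.2]

end Gibbs

/-! ### Conditional densities as functions of one row of the network -/

variable {E : Type*} [MeasurableSpace E] (𝓐 : AutoModelData E) {S : Type*} [LinearOrder S]

instance : IsFiniteMeasure 𝓐.ρ := 𝓐.finite_ρ

/-- A bound for the interaction function `B`. -/
noncomputable def boundB : ℝ := |𝓐.bounded_B.choose|

/-- A bound for `A`. -/
noncomputable def boundA : ℝ := |𝓐.bounded_A.choose|

lemma boundB_nonneg : 0 ≤ 𝓐.boundB := abs_nonneg _

lemma abs_B_le (x y : E) : |𝓐.B x y| ≤ 𝓐.boundB :=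
  (𝓐.bounded_B.choose_spec x y).trans (le_abs_self _)

lemma abs_A_le (x : E) : |𝓐.A x| ≤ 𝓐.boundA :=
  (𝓐.bounded_A.choose_spec x).trans (le_abs_self _)

/-- The value `B (u, X_ℓ)`, where `u` is the value at `s`. -/
def interaction (s : S) (x : S → E) (u : E) (ℓ : S) : ℝ := 𝓐.B u (Function.update x s u ℓ)

lemma interaction_self (s : S) (x : S → E) (u : E) : 𝓐.interaction s x u s = 𝓐.B₀ u := by
  simp [interaction, 𝓐.diag_B]

lemma interaction_of_ne {s ℓ : S} (h : ℓ ≠ s) (x : S → E) (u : E) :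
    𝓐.interaction s x u ℓ = 𝓐.B u (x ℓ) := by
  simp [interaction, h]

lemma interaction_update (s ℓ : S) (x : S → E) (u v : E) :
    𝓐.interaction s (Function.update x s v) u ℓ = 𝓐.interaction s x u ℓ := by
  simp [interaction]

/-- The exponent of the conditional density at `s` as a function of a row `a` of the network. -/
noncomputable def fieldExponent (a : S → ℝ) (s : S) (x : S → E) (u : E) : ℝ :=
  𝓐.A u + ∑' ℓ, a ℓ * 𝓐.interaction s x u ℓ

/-- The conditional density at `s` as a function of a row `a` of the network. -/
noncomputable def rowDensity (a : S → ℝ) (s : S) (x : S → E) (u : E) : ℝ :=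
  Real.exp (𝓐.fieldExponent a s x u) / ∫ v, Real.exp (𝓐.fieldExponent a s x v) ∂𝓐.ρ

lemma summable_mul_interaction {a : S → ℝ} (ha : Summable a) (s : S) (x : S → E) (u : E) :
    Summable fun ℓ => a ℓ * 𝓐.interaction s x u ℓ := by
  refine Summable.of_norm_bounded (ha.abs.mul_right 𝓐.boundB) fun ℓ => ?_
  rw [norm_mul]
  exact mul_le_mul_of_nonneg_left (𝓐.abs_B_le _ _) (norm_nonneg _)

lemma abs_tsum_mul_interaction_le {a : S → ℝ} (ha : Summable a) (s : S) (x : S → E) (u : E) :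
    |∑' ℓ, a ℓ * 𝓐.interaction s x u ℓ| ≤ 𝓐.boundB * ∑' ℓ, |a ℓ| := by
  rw [← tsum_mul_left, ← Real.norm_eq_abs]
  refine tsum_of_norm_bounded (ha.abs.mul_left 𝓐.boundB).hasSum fun ℓ => ?_
  rw [norm_mul, mul_comm]
  exact mul_le_mul_of_nonneg_right (𝓐.abs_B_le _ _) (norm_nonneg _)

lemma abs_fieldExponent_le {a : S → ℝ} (ha : Summable a) (s : S) (x : S → E) (u : E) :
    |𝓐.fieldExponent a s x u| ≤ 𝓐.boundA + 𝓐.boundB * ∑' ℓ, |a ℓ| :=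
  (abs_add_le _ _).trans (add_le_add (𝓐.abs_A_le u) (𝓐.abs_tsum_mul_interaction_le ha s x u))

lemma abs_fieldExponent_sub_le {a b : S → ℝ} (ha : Summable a) (hb : Summable b) (s : S)
    (x : S → E) (u : E) :
    |𝓐.fieldExponent a s x u - 𝓐.fieldExponent b s x u| ≤ 𝓐.boundB * ∑' ℓ, |a ℓ - b ℓ| := by
  have h := 𝓐.abs_tsum_mul_interaction_le (ha.sub hb) s x u
  simp only [sub_mul] at h
  rw [(𝓐.summable_mul_interaction ha s x u).tsum_sub (𝓐.summable_mul_interaction hb s x u)] at h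
  simpa [fieldExponent] using h

lemma fieldExponent_update (a : S → ℝ) (s : S) (x : S → E) (u v : E) :
    𝓐.fieldExponent a s (Function.update x s v) u = 𝓐.fieldExponent a s x u := by
  simp [fieldExponent, interaction_update]

lemma rowDensity_update (a : S → ℝ) (s : S) (x : S → E) (u v : E) :
    𝓐.rowDensity a s (Function.update x s v) u = 𝓐.rowDensity a s x u := by
  simp [rowDensity, fieldExponent_update]

lemma measurable_interaction (s ℓ : S) :
    Measurable fun p : (S → E) × E => 𝓐.interaction s p.1 p.2 ℓ := by
  have h : Measurable fun p : (S → E) × E => (p.2, Function.update p.1 s p.2 ℓ) :=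
    measurable_snd.prodMk ((measurable_pi_apply ℓ).comp measurable_update')
  exact 𝓐.measurable_B.comp h

lemma measurable_fieldExponent [Countable S] {a : S → ℝ} (ha : Summable a) (s : S) :
    Measurable fun p : (S → E) × E => 𝓐.fieldExponent a s p.1 p.2 := by
  refine (𝓐.measurable_A.comp measurable_snd).add ?_
  refine measurable_of_tendsto_metrizable' (atTop : Filter (Finset S))
    (f := fun T (p : (S → E) × E) => ∑ ℓ ∈ T, a ℓ * 𝓐.interaction s p.1 p.2 ℓ)
    (fun T => Finset.measurable_fun_sum _ fun ℓ _ => (𝓐.measurable_interaction s ℓ).const_mul _) ?_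
  rw [tendsto_pi_nhds]
  exact fun p => (𝓐.summable_mul_interaction ha s p.1 p.2).hasSum

lemma measurable_fieldExponent_right [Countable S] {a : S → ℝ} (ha : Summable a) (s : S)
    (x : S → E) : Measurable (𝓐.fieldExponent a s x) :=
  (𝓐.measurable_fieldExponent ha s).comp measurable_prodMk_left

lemma measurable_rowDensity [Countable S] {a : S → ℝ} (ha : Summable a) (s : S) :
    Measurable fun p : (S → E) × E => 𝓐.rowDensity a s p.1 p.2 := by
  have h := (𝓐.measurable_fieldExponent ha s).exp
  refine h.div ?_
  have h2 : StronglyMeasurable fun x : S → E =>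
      ∫ v, Real.exp (𝓐.fieldExponent a s x v) ∂𝓐.ρ :=
    h.stronglyMeasurable.integral_prod_right
  exact h2.measurable.comp measurable_fst

section NeZero

variable [NeZero 𝓐.ρ] [Countable S]

lemma partition_pos {a : S → ℝ} (ha : Summable a) (s : S) (x : S → E) :
    0 < ∫ v, Real.exp (𝓐.fieldExponent a s x v) ∂𝓐.ρ :=
  integral_exp_pos_of_bounded (𝓐.measurable_fieldExponent_right ha s x)
    (𝓐.abs_fieldExponent_le ha s x)

lemma rowDensity_pos {a : S → ℝ} (ha : Summable a) (s : S) (x : S → E) (u : E) :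
    0 < 𝓐.rowDensity a s x u :=
  div_pos (Real.exp_pos _) (𝓐.partition_pos ha s x)

lemma lintegral_rowDensity {a : S → ℝ} (ha : Summable a) (s : S) (x : S → E) :
    ∫⁻ u, ENNReal.ofReal (𝓐.rowDensity a s x u) ∂𝓐.ρ = 1 := by
  rw [← ofReal_integral_eq_lintegral_ofReal]
  · simp only [rowDensity]
    rw [integral_div, div_self (𝓐.partition_pos ha s x).ne', ENNReal.ofReal_one]
  · exact (integrable_exp_of_bounded (𝓐.measurable_fieldExponent_right ha s x)
      (𝓐.abs_fieldExponent_le ha s x)).div_const _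
  · exact Eventually.of_forall fun u => (𝓐.rowDensity_pos ha s x u).le

lemma abs_log_rowDensity_sub_le {a b : S → ℝ} (ha : Summable a) (hb : Summable b) (s : S)
    (x : S → E) (u : E) :
    |Real.log (𝓐.rowDensity a s x u) - Real.log (𝓐.rowDensity b s x u)|
      ≤ 2 * 𝓐.boundB * ∑' ℓ, |a ℓ - b ℓ| := by
  rw [mul_assoc]
  exact abs_log_normalized_exp_sub_le (𝓐.measurable_fieldExponent_right ha s x)
    (𝓐.measurable_fieldExponent_right hb s x) (𝓐.abs_fieldExponent_le ha s x)
    (𝓐.abs_fieldExponent_le hb s x) (𝓐.abs_fieldExponent_sub_le ha hb s x) u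

lemma log_rowDensity {a : S → ℝ} (ha : Summable a) (s : S) (x : S → E) (u : E) :
    Real.log (𝓐.rowDensity a s x u) = 𝓐.fieldExponent a s x u
      - Real.log (∫ v, Real.exp (𝓐.fieldExponent a s x v) ∂𝓐.ρ) := by
  rw [rowDensity, Real.log_div (Real.exp_pos _).ne' (𝓐.partition_pos ha s x).ne', Real.log_exp]

end NeZero

/-- Since `B x x = B₀ x`, the diagonal term is the `ℓ = s` term of the interaction series, and
restricting to `T` amounts to zeroing the row outside `T`. Full and truncated densities thus become
one function of a summable row. -/
lemma energy_eq_fieldExponent {θ : S → S → ℝ} {T : Set S} {s : S} (hs : s ∈ T)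
    (hθ : Summable (T.indicator (θ s))) (x : S → E) (u : E) :
    𝓐.energy θ T s x u = 𝓐.fieldExponent (T.indicator (θ s)) s x u := by
  rw [energy, fieldExponent, (𝓐.summable_mul_interaction hθ s x u).tsum_eq_add_tsum_ite s,
    interaction_self, Set.indicator_of_mem hs, add_assoc]
  congr 2
  rw [tsum_subtype (T \ {s}) fun ℓ => θ s ℓ * 𝓐.B u (x ℓ)]
  refine tsum_congr fun ℓ => ?_
  by_cases h : ℓ = s
  · simp [h]
  · rw [if_neg h, 𝓐.interaction_of_ne h]
    by_cases hT : ℓ ∈ T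
    · rw [Set.indicator_of_mem (show ℓ ∈ T \ {s} from ⟨hT, h⟩), Set.indicator_of_mem hT]
    · rw [Set.indicator_of_notMem (fun h' => hT h'.1), Set.indicator_of_notMem hT, zero_mul]

lemma condDensity_eq_rowDensity {θ : S → S → ℝ} {T : Set S} {s : S} (hs : s ∈ T)
    (hθ : Summable (T.indicator (θ s))) (x : S → E) (u : E) :
    𝓐.condDensity θ T s x u = 𝓐.rowDensity (T.indicator (θ s)) s x u := by
  simp only [condDensity, rowDensity, 𝓐.energy_eq_fieldExponent hs hθ]

lemma condDensity_univ {θ : S → S → ℝ} {s : S} (hθ : Summable (θ s)) (x : S → E) (u : E) :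
    𝓐.condDensity θ Set.univ s x u = 𝓐.rowDensity (θ s) s x u := by
  rw [𝓐.condDensity_eq_rowDensity (Set.mem_univ s) (by simpa using hθ), Set.indicator_univ]

lemma condLaw_eq {θ : S → S → ℝ} {s : S} (hθ : Summable (θ s)) (x : S → E) :
    𝓐.condLaw θ s x = 𝓐.ρ.withDensity fun u => ENNReal.ofReal (𝓐.rowDensity (θ s) s x u) := by
  simp only [condLaw, 𝓐.condDensity_univ hθ]

end AutoModelData

/-! ### Resampling one coordinate of an auto-model law -/

namespace AutoModelData

variable {E : Type*} [MeasurableSpace E] (𝓐 : AutoModelData E) {S : Type*}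
  {θ : S → S → ℝ} {μ : Measure (S → E)}

namespace IsAutoModelLaw

variable {𝓐}

/-- If `ρ` vanished, every conditional law would have mass 0, whereas the conditional expectation of
the constant 1 is 1. -/
lemma neZero (h : 𝓐.IsAutoModelLaw θ μ) [Nonempty S] : NeZero 𝓐.ρ := by
  refine ⟨fun h0 => ?_⟩
  have := h.1
  obtain ⟨s⟩ := ‹Nonempty S›
  have h1 := h.2 s Set.univ MeasurableSet.univ
  have h2 : ∀ x, (𝓐.condLaw θ s x).real Set.univ = 0 := fun x => by
    simp [condLaw, h0, Measure.real]
  simp only [h2, Set.preimage_univ, Set.indicator_univ] at h1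
  rw [condExp_const cylinderEvents_le_pi] at h1
  obtain ⟨x, hx⟩ := h1.exists
  norm_num at hx

variable [LinearOrder S] [Countable S]

lemma isProbabilityMeasure_condLaw [NeZero 𝓐.ρ] {s : S} (hθ : Summable (θ s)) (x : S → E) :
    IsProbabilityMeasure (𝓐.condLaw θ s x) := ⟨by
  rw [𝓐.condLaw_eq hθ, withDensity_apply _ MeasurableSet.univ, Measure.restrict_univ,
    𝓐.lintegral_rowDensity hθ]⟩

lemma measure_inter_preimage (h : 𝓐.IsAutoModelLaw θ μ) [NeZero 𝓐.ρ] {s : S}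
    (hθ : Summable (θ s)) {F : Set E} (hF : MeasurableSet F) {C : Set (S → E)}
    (hC : MeasurableSet[cylinderEvents {s}ᶜ] C) :
    μ ((fun x : S → E => x s) ⁻¹' F ∩ C) = ∫⁻ x in C, 𝓐.condLaw θ s x F ∂μ := by
  have := h.1
  have hs : MeasurableSet ((fun x : S → E => x s) ⁻¹' F) := measurable_pi_apply s hF
  have hprob := isProbabilityMeasure_condLaw (𝓐 := 𝓐) hθ
  have h1 := setIntegral_condExp (μ := μ) (cylinderEvents_le_pi (Δ := {s}ᶜ))
    ((integrable_const (1 : ℝ)).indicator hs) hC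
  rw [setIntegral_congr_ae (g := fun x => (𝓐.condLaw θ s x).real F)
    (cylinderEvents_le_pi _ hC) ((h.2 s F hF).mono fun x hx _ => hx)] at h1
  have hmeas : Measurable fun x => 𝓐.condLaw θ s x F := by
    simp only [𝓐.condLaw_eq hθ, withDensity_apply _ hF]
    exact Measurable.lintegral_prod_right' (ν := 𝓐.ρ.restrict F)
      (𝓐.measurable_rowDensity hθ s).ennreal_ofReal
  rw [integral_indicator hs, Measure.restrict_restrict hs, setIntegral_const, smul_eq_mul,
    mul_one] at h1
  simp only [Measure.real] at h1
  rw [integral_toReal hmeas.aemeasurable (Eventually.of_forall fun x => measure_lt_top _ _)] at h1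
  rw [eq_comm, ENNReal.toReal_eq_toReal_iff' (measure_ne_top _ _)] at h1
  · exact h1
  · refine ne_top_of_le_ne_top (measure_ne_top μ C) ?_
    calc ∫⁻ x in C, 𝓐.condLaw θ s x F ∂μ ≤ ∫⁻ _ in C, 1 ∂μ := lintegral_mono fun x => prob_le_one
      _ = μ C := by simp

/-- Resampling the value at `s` from its conditional density leaves the law invariant. -/
lemma eq_map_update (h : 𝓐.IsAutoModelLaw θ μ) [NeZero 𝓐.ρ] {s : S} (hθ : Summable (θ s)) :
    μ = ((μ.prod 𝓐.ρ).withDensity fun p => ENNReal.ofReal (𝓐.rowDensity (θ s) s p.1 p.2)).map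
      fun p => Function.update p.1 s p.2 := by
  have := h.1
  have hd : Measurable fun p : (S → E) × E => ENNReal.ofReal (𝓐.rowDensity (θ s) s p.1 p.2) :=
    (𝓐.measurable_rowDensity hθ s).ennreal_ofReal
  refine ext_of_generate_finite _ (generateFrom_squareCylinders (α := fun _ : S => E)).symm
    (isPiSystem_squareCylinders (fun _ => MeasurableSpace.isPiSystem_measurableSet) (by simp)) ?_ ?_
  · rintro _ ⟨I, t, ht, rfl⟩
    have ht' : ∀ i, MeasurableSet (t i) := fun i => ht i (Set.mem_univ i)
    classical
    -- Filling with `univ` off `I` lets the box split into a condition at `s` and one on the other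
    -- nodes, whether or not `s ∈ I`.
    set t' : S → Set E := fun i => if i ∈ I then t i else Set.univ with ht'def
    have ht'm : ∀ i, MeasurableSet (t' i) := fun i => by
      simp only [ht'def]; split_ifs; exacts [ht' i, MeasurableSet.univ]
    set C : Set (S → E) := ((I.erase s : Finset S) : Set S).pi t' with hCdef
    have hsplit : (I : Set S).pi t = (fun x : S → E => x s) ⁻¹' (t' s) ∩ C := by
      ext x
      simp only [hCdef, Set.mem_pi, Set.mem_inter_iff, Set.mem_preimage, Finset.mem_coe,
        Finset.mem_erase, ht'def]
      constructor
      · intro hx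
        refine ⟨?_, fun i hi => by simpa [hi.2] using hx i hi.2⟩
        by_cases hsI : s ∈ I
        · simpa [hsI] using hx s hsI
        · simp [hsI]
      · rintro ⟨h1, h2⟩ i hi
        by_cases his : i = s
        · subst his; simpa [hi] using h1
        · simpa [hi] using h2 i ⟨his, hi⟩
    have hC : MeasurableSet[cylinderEvents {s}ᶜ] C := by
      rw [hCdef, Set.pi_def]
      refine MeasurableSet.biInter (Finset.countable_toSet _) fun i hi => ?_
      exact measurable_cylinderEvent_apply (X := fun _ : S => E) (Δ := {s}ᶜ)
        (by simpa using (Finset.mem_erase.1 hi).1) (ht'm i)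
    have hCu : ∀ x u, Function.update x s u ∈ C ↔ x ∈ C := fun x u => by
      simp only [hCdef, Set.mem_pi]
      refine forall₂_congr fun i hi => ?_
      rw [Function.update_of_ne (Finset.mem_erase.1 hi).1]
    have hCm := cylinderEvents_le_pi _ hC
    have hbox : MeasurableSet ((fun x : S → E => x s) ⁻¹' (t' s) ∩ C) :=
      (measurable_pi_apply s (ht'm s)).inter hCm
    rw [hsplit, h.measure_inter_preimage hθ (ht'm s) hC, Measure.map_apply measurable_update' hbox,
      withDensity_apply _ (measurable_update' hbox),
      ← lintegral_indicator (measurable_update' hbox),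
      lintegral_prod _ (hd.indicator (measurable_update' hbox)).aemeasurable,
      ← lintegral_indicator hCm]
    refine lintegral_congr fun x => ?_
    by_cases hx : x ∈ C
    · rw [Set.indicator_of_mem hx, 𝓐.condLaw_eq hθ, withDensity_apply _ (ht'm s),
        ← lintegral_indicator (ht'm s)]
      refine lintegral_congr fun u => ?_
      simp [Set.indicator, hCu, hx]
    · simp [Set.indicator, hCu, hx]
  · rw [Measure.map_apply measurable_update' MeasurableSet.univ, Set.preimage_univ,
      withDensity_apply _ MeasurableSet.univ, Measure.restrict_univ,
      lintegral_prod _ hd.aemeasurable]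
    simp [𝓐.lintegral_rowDensity hθ]

lemma lintegral_eq (h : 𝓐.IsAutoModelLaw θ μ) [NeZero 𝓐.ρ] {s : S} (hθ : Summable (θ s))
    {H : (S → E) → ENNReal} (hH : Measurable H) :
    ∫⁻ x, H x ∂μ = ∫⁻ x, ∫⁻ u, ENNReal.ofReal (𝓐.rowDensity (θ s) s x u)
      * H (Function.update x s u) ∂𝓐.ρ ∂μ := by
  have := h.1
  have hd : Measurable fun p : (S → E) × E => ENNReal.ofReal (𝓐.rowDensity (θ s) s p.1 p.2) :=
    (𝓐.measurable_rowDensity hθ s).ennreal_ofReal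
  have hHu : Measurable fun p : (S → E) × E => H (Function.update p.1 s p.2) :=
    hH.comp measurable_update'
  conv_lhs => rw [h.eq_map_update hθ]
  rw [lintegral_map hH measurable_update', lintegral_withDensity_eq_lintegral_mul _ hd hHu,
    lintegral_prod _ (hd.mul hHu).aemeasurable]
  rfl

/-- An almost sure property persists when the value at `s` is resampled from `ρ`. -/
lemma ae_update (h : 𝓐.IsAutoModelLaw θ μ) [NeZero 𝓐.ρ] {s : S} (hθ : Summable (θ s))
    {p : (S → E) → Prop} (hp : ∀ᵐ x ∂μ, p x) :
    ∀ᵐ x ∂μ, ∀ᵐ u ∂𝓐.ρ, p (Function.update x s u) := by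
  have := h.1
  obtain ⟨N, hN, hNm, hN0⟩ := exists_measurable_superset_of_null (ae_iff.1 hp)
  have h1 := h.lintegral_eq hθ (measurable_const.indicator hNm : Measurable (N.indicator 1))
  rw [lintegral_indicator_one hNm, hN0, eq_comm] at h1
  have hd : Measurable fun p : (S → E) × E => ENNReal.ofReal (𝓐.rowDensity (θ s) s p.1 p.2) :=
    (𝓐.measurable_rowDensity hθ s).ennreal_ofReal
  have hm : Measurable fun p : (S → E) × E => ENNReal.ofReal (𝓐.rowDensity (θ s) s p.1 p.2)
      * N.indicator 1 (Function.update p.1 s p.2) :=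
    hd.mul ((measurable_const.indicator hNm).comp measurable_update')
  rw [lintegral_eq_zero_iff (Measurable.lintegral_prod_right' (ν := 𝓐.ρ) hm)] at h1
  filter_upwards [h1] with x hx
  have hx' : ∫⁻ u, ENNReal.ofReal (𝓐.rowDensity (θ s) s x u)
      * N.indicator 1 (Function.update x s u) ∂𝓐.ρ = 0 := hx
  rw [lintegral_eq_zero_iff (by exact hm.comp measurable_prodMk_left)] at hx'
  filter_upwards [hx'] with u hu
  -- The density is strictly positive, so a vanishing product forces the indicator of `N` to vanish.
  by_contra hpu
  have : Function.update x s u ∈ N := hN hpu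
  simp only [Pi.zero_apply, Set.indicator_of_mem this, Pi.one_apply, mul_one,
    ENNReal.ofReal_eq_zero] at hu
  exact absurd (𝓐.rowDensity_pos hθ s x u) (not_lt.2 hu)

/-- The one-dimensional marginals are absolutely continuous with respect to `ρ`. -/
lemma ae_apply (h : 𝓐.IsAutoModelLaw θ μ) [NeZero 𝓐.ρ] {s : S} (hθ : Summable (θ s))
    {p : E → Prop} (hp : ∀ᵐ u ∂𝓐.ρ, p u) : ∀ᵐ x ∂μ, p (x s) := by
  have := h.1
  obtain ⟨N, hN, hNm, hN0⟩ := exists_measurable_superset_of_null (ae_iff.1 hp)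
  have h1 := h.measure_inter_preimage hθ hNm MeasurableSet.univ
  have h2 : ∀ x, 𝓐.condLaw θ s x N = 0 := fun x =>
    withDensity_absolutelyContinuous _ _ hN0
  simp only [h2, lintegral_zero, Set.inter_univ] at h1
  exact measure_mono_null (fun x hx => hN hx) h1

end IsAutoModelLaw

end AutoModelData

/-! ### Two facts on covariances and positive definite matrices -/

lemma covariance_congr_add_const {E : Type*} [MeasurableSpace E] {κ : Measure E}
    [IsProbabilityMeasure κ] {f g k : E → ℝ} {c : ℝ} (hfg : f =ᵐ[κ] fun u => g u + c)
    (hg : Integrable g κ) : covariance f k κ = covariance g k κ := by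
  simp only [covariance]
  have h1 : ∫ u, f u ∂κ = (∫ u, g u ∂κ) + c := by
    rw [integral_congr_ae hfg, integral_add hg (integrable_const c)]
    simp
  rw [h1]
  refine integral_congr_ae ?_
  filter_upwards [hfg] with u hu
  rw [hu]
  ring

/-- Equal rows would make the quadratic form vanish at `e_i - e_j`. -/
lemma Matrix.PosDef.row_ne {n : Type*} {M : Matrix n n ℝ} (hM : M.PosDef) {i j : n} (hij : i ≠ j) :
    M i ≠ M j := by
  intro h
  have he : Function.Injective ![i, j] := by
    intro a b hab
    fin_cases a <;> fin_cases b <;> simp_all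
  have h1 := (Matrix.posDef_iff_dotProduct_mulVec.1 (hM.submatrix he)).2
    (x := ![1, -1]) (by simp)
  have h2 := congrFun h i
  have h3 := congrFun h j
  simp [Matrix.mulVec, dotProduct, Fin.sum_univ_two] at h1
  linarith

/-! ### Contrasts, Kullback-Leibler divergence and identifiability -/

namespace AutoModelData

variable {E : Type*} [MeasurableSpace E] (𝓐 : AutoModelData E) {S : Type*} [LinearOrder S]

/-- The difference of the conditional log-likelihoods at `s` of two rows `a` and `b`. -/
noncomputable def contrast (a b : S → ℝ) (s : S) (x : S → E) : ℝ :=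
  Real.log (𝓐.rowDensity a s x (x s)) - Real.log (𝓐.rowDensity b s x (x s))

variable [Countable S] {a b : S → ℝ}

lemma measurable_contrast (ha : Summable a) (hb : Summable b) (s : S) :
    Measurable (𝓐.contrast a b s) := by
  have h : Measurable fun x : S → E => (x, x s) := measurable_id.prodMk (measurable_pi_apply s)
  exact ((𝓐.measurable_rowDensity ha s).comp h).log.sub ((𝓐.measurable_rowDensity hb s).comp h).log

lemma abs_contrast_le [NeZero 𝓐.ρ] (ha : Summable a) (hb : Summable b) (s : S) (x : S → E) :
    |𝓐.contrast a b s x| ≤ 2 * 𝓐.boundB * ∑' ℓ, |a ℓ - b ℓ| :=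
  𝓐.abs_log_rowDensity_sub_le ha hb s x (x s)

lemma integrable_contrast [NeZero 𝓐.ρ] (ha : Summable a) (hb : Summable b) (s : S)
    (μ : Measure (S → E)) [IsFiniteMeasure μ] : Integrable (𝓐.contrast a b s) μ :=
  Integrable.of_bound (𝓐.measurable_contrast ha hb s).aestronglyMeasurable _
    (Eventually.of_forall (𝓐.abs_contrast_le ha hb s))

namespace IsAutoModelLaw

variable {𝓐} {θ : S → S → ℝ} {μ : Measure (S → E)} [NeZero 𝓐.ρ] {s : S}

/-- The exponential of the contrast is a ratio of conditional densities. Integrating out the value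
at `s` first leaves the total mass of the density with row `a`. -/
lemma integral_exp_contrast (h : 𝓐.IsAutoModelLaw θ μ) (ha : Summable a) (hθ : Summable (θ s)) :
    ∫ x, Real.exp (𝓐.contrast a (θ s) s x) ∂μ = 1 := by
  have hm := (𝓐.measurable_contrast ha hθ s).exp
  rw [integral_eq_lintegral_of_nonneg_ae (Eventually.of_forall fun x => (Real.exp_pos _).le)
    hm.aestronglyMeasurable, h.lintegral_eq hθ hm.ennreal_ofReal]
  have := h.1
  have key : ∀ x : S → E, ∫⁻ u, ENNReal.ofReal (𝓐.rowDensity (θ s) s x u)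
      * ENNReal.ofReal (Real.exp (𝓐.contrast a (θ s) s (Function.update x s u))) ∂𝓐.ρ = 1 := by
    intro x
    rw [← 𝓐.lintegral_rowDensity ha s x]
    refine lintegral_congr fun u => ?_
    have hpos := 𝓐.rowDensity_pos hθ s x u
    rw [← ENNReal.ofReal_mul hpos.le, contrast, rowDensity_update, rowDensity_update,
      Function.update_self, Real.exp_sub, Real.exp_log hpos,
      Real.exp_log (𝓐.rowDensity_pos ha s x u), mul_div_cancel₀ _ hpos.ne']
  simp [key]

lemma integrable_exp_contrast (h : 𝓐.IsAutoModelLaw θ μ) (ha : Summable a)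
    (hθ : Summable (θ s)) : Integrable (fun x => Real.exp (𝓐.contrast a (θ s) s x)) μ :=
  have := h.1
  integrable_exp_of_bounded (𝓐.measurable_contrast ha hθ s) (𝓐.abs_contrast_le ha hθ s)

/-- The divergence becomes the integral of `exp t - 1 - t`, which is nonnegative and vanishes only
at `t = 0`. This yields both the sign and the equality case. -/
lemma integral_exp_sub_one_sub_contrast (h : 𝓐.IsAutoModelLaw θ μ) (ha : Summable a)
    (hθ : Summable (θ s)) :
    ∫ x, (Real.exp (𝓐.contrast a (θ s) s x) - 1 - 𝓐.contrast a (θ s) s x) ∂μ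
      = - ∫ x, 𝓐.contrast a (θ s) s x ∂μ := by
  have := h.1
  have hi := h.integrable_exp_contrast ha hθ
  rw [integral_sub (f := fun x => Real.exp (𝓐.contrast a (θ s) s x) - 1)
      (hi.sub (integrable_const 1)) (𝓐.integrable_contrast ha hθ s μ),
    integral_sub hi (integrable_const 1), h.integral_exp_contrast ha hθ]
  simp

/-- The Kullback-Leibler divergence between conditional densities is nonnegative. -/
lemma integral_contrast_nonpos (h : 𝓐.IsAutoModelLaw θ μ) (ha : Summable a)
    (hθ : Summable (θ s)) : ∫ x, 𝓐.contrast a (θ s) s x ∂μ ≤ 0 := by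
  rw [← neg_nonneg, ← h.integral_exp_sub_one_sub_contrast ha hθ]
  exact integral_nonneg fun x => by
    have := Real.add_one_le_exp (𝓐.contrast a (θ s) s x)
    simp only [Pi.zero_apply]
    linarith

lemma contrast_ae_eq_zero (h : 𝓐.IsAutoModelLaw θ μ) (ha : Summable a) (hθ : Summable (θ s))
    (h0 : ∫ x, 𝓐.contrast a (θ s) s x ∂μ = 0) : 𝓐.contrast a (θ s) s =ᵐ[μ] 0 := by
  have := h.1
  have h1 := h.integral_exp_sub_one_sub_contrast ha hθ
  rw [h0, neg_zero, integral_eq_zero_iff_of_nonneg] at h1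
  · filter_upwards [h1] with x hx
    by_contra hne
    have := Real.add_one_lt_exp hne
    simp only [Pi.zero_apply] at hx
    linarith
  · intro x
    have := Real.add_one_le_exp (𝓐.contrast a (θ s) s x)
    simp only [Pi.zero_apply]
    linarith
  · exact ((h.integrable_exp_contrast ha hθ).sub (integrable_const 1)).sub
      (𝓐.integrable_contrast ha hθ s μ)

/-- Resampling at `s` turns equality of the two densities at the observed value into equality for
`ρ`-almost every `u`. The log-normalizers do not involve `u`, so the difference of the exponents is
constant in `u`. -/
lemma ae_tsum_eq_of_contrast (h : 𝓐.IsAutoModelLaw θ μ) (ha : Summable a) (hθ : Summable (θ s))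
    (h0 : 𝓐.contrast a (θ s) s =ᵐ[μ] 0) :
    ∃ c : (S → E) → ℝ, ∀ᵐ x ∂μ, ∀ᵐ u ∂𝓐.ρ,
      ∑' ℓ, (a ℓ - θ s ℓ) * 𝓐.interaction s x u ℓ = c x := by
  refine ⟨fun x => Real.log (∫ v, Real.exp (𝓐.fieldExponent a s x v) ∂𝓐.ρ)
    - Real.log (∫ v, Real.exp (𝓐.fieldExponent (θ s) s x v) ∂𝓐.ρ), ?_⟩
  filter_upwards [h.ae_update hθ h0] with x hx
  filter_upwards [hx] with u hu
  rw [contrast, Function.update_self, rowDensity_update, rowDensity_update,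
    𝓐.log_rowDensity ha, 𝓐.log_rowDensity hθ] at hu
  simp only [sub_mul]
  rw [(𝓐.summable_mul_interaction ha s x u).tsum_sub (𝓐.summable_mul_interaction hθ s x u)]
  simp only [fieldExponent, Pi.zero_apply] at hu ⊢
  linarith

lemma integrable_interaction (hθ : Summable (θ s)) (x : S → E) (ℓ : S) :
    Integrable (fun u => 𝓐.interaction s x u ℓ) (𝓐.condLaw θ s x) :=
  have := isProbabilityMeasure_condLaw (𝓐 := 𝓐) hθ x
  Integrable.of_bound (C := 𝓐.boundB)
    ((𝓐.measurable_interaction s ℓ).comp measurable_prodMk_left).aestronglyMeasurable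
    (Eventually.of_forall fun _ => 𝓐.abs_B_le _ _)

/-- Absolutely summable rows are identifiable: linear independence of the interactions for finitely
supported rows entails the same for infinite ones, thanks to the positive conditional densities. -/
lemma not_ae_tsum_eq [Infinite S] (h : 𝓐.IsAutoModelLaw θ μ) (hθ : ∀ s, Summable (θ s))
    (hpos : (𝓐.condCovMatrix θ s μ).PosDef) {d : S → ℝ} (hd : Summable d) (hd0 : d ≠ 0)
    (c : (S → E) → ℝ)
    (hc : ∀ᵐ x ∂μ, ∀ᵐ u ∂𝓐.ρ, ∑' ℓ, d ℓ * 𝓐.interaction s x u ℓ = c x) : False := by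
  have := h.1
  have hac : ∀ x, 𝓐.condLaw θ s x ≪ 𝓐.ρ := fun x => withDensity_absolutelyContinuous _ _
  have hprob := isProbabilityMeasure_condLaw (𝓐 := 𝓐) (hθ s)
  by_cases hex : ∃ ℓ, ℓ ≠ s ∧ d ℓ ≠ 0
  · obtain ⟨ℓ, hℓs, hdℓ⟩ := hex
    -- Freeze one good configuration and vary only its value `y` at `ℓ`. The other terms of the
    -- series do not see `y`, so solving for the `ℓ` term shows that `B` is additively separable
    -- almost everywhere.
    obtain ⟨x₀, hx₀⟩ := (h.ae_update (hθ ℓ) hc).exists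
    obtain ⟨α, β, hαβ⟩ : ∃ α β : E → ℝ, ∀ᵐ y ∂𝓐.ρ, ∀ᵐ u ∂𝓐.ρ, 𝓐.B u y = α u + β y := by
      refine ⟨fun u => -(∑' k, if k = ℓ then 0 else d k * 𝓐.interaction s x₀ u k) / d ℓ,
        fun y => c (Function.update x₀ ℓ y) / d ℓ, ?_⟩
      filter_upwards [hx₀] with y hy
      filter_upwards [hy] with u hu
      rw [(𝓐.summable_mul_interaction hd s _ u).tsum_eq_add_tsum_ite ℓ,
        𝓐.interaction_of_ne hℓs, Function.update_self] at hu
      have hcongr : (∑' k, if k = ℓ then 0 else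
            d k * 𝓐.interaction s (Function.update x₀ ℓ y) u k)
          = ∑' k, if k = ℓ then 0 else d k * 𝓐.interaction s x₀ u k := by
        refine tsum_congr fun k => ?_
        split_ifs with hk
        · rfl
        · by_cases hks : k = s
          · rw [hks, interaction_self, interaction_self]
          · rw [𝓐.interaction_of_ne hks, 𝓐.interaction_of_ne hks, Function.update_of_ne hk]
      rw [hcongr] at hu
      rw [← hu]
      field_simp
      ring
    -- With `B` separable, the interactions of `s` with any two other nodes differ by a constant
    -- once the field off `s` is fixed. The two corresponding rows of the covariance matrix then
    -- coincide.
    obtain ⟨ℓ₁, hℓ₁⟩ := Infinite.exists_notMem_finset ({s} : Finset S)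
    obtain ⟨ℓ₂, hℓ₂⟩ := Infinite.exists_notMem_finset ({s, ℓ₁} : Finset S)
    simp only [Finset.mem_singleton, Finset.mem_insert, not_or] at hℓ₁ hℓ₂
    refine hpos.row_ne (i := ℓ₁) (j := ℓ₂) (Ne.symm hℓ₂.2) (funext fun k => ?_)
    simp only [condCovMatrix, Matrix.of_apply]
    refine integral_congr_ae ?_
    filter_upwards [h.ae_apply (hθ ℓ₁) hαβ, h.ae_apply (hθ ℓ₂) hαβ] with x h1 h2
    refine covariance_congr_add_const (c := β (x ℓ₁) - β (x ℓ₂)) (hac x ?_)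
      (integrable_interaction (hθ s) x ℓ₂)
    filter_upwards [h1, h2] with u hu1 hu2
    rw [Function.update_of_ne hℓ₁, Function.update_of_ne hℓ₂.1, hu1, hu2]
    ring
  · push Not at hex
    -- Only the diagonal coefficient survives, so `B₀` is almost everywhere constant and the
    -- diagonal entry at `s` is zero.
    have hds : d s ≠ 0 := fun h0 => hd0 <| funext fun ℓ => by
      by_cases hℓ : ℓ = s
      · rw [hℓ, h0]; rfl
      · exact hex ℓ hℓ
    refine hpos.diag_pos (i := s) |>.ne' ?_
    simp only [condCovMatrix, Matrix.of_apply]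
    rw [integral_congr_ae (g := fun _ => (0 : ℝ)) _, integral_zero]
    filter_upwards [hc] with x hx
    rw [covariance_congr_add_const (g := fun _ => 0) (c := c x / d s) (hac x ?_)
      (integrable_const 0)]
    · exact covariance_const_left 0
    · filter_upwards [hx] with u hu
      rw [tsum_eq_single s fun k hk => by rw [hex k hk, zero_mul]] at hu
      change 𝓐.interaction s x u s = _
      rw [← hu]
      field_simp
      ring

/-- The expected contrast of a wrong row is negative. -/
lemma integral_contrast_neg [Infinite S] (h : 𝓐.IsAutoModelLaw θ μ) (hθ : ∀ s, Summable (θ s))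
    (hpos : (𝓐.condCovMatrix θ s μ).PosDef) (ha : Summable a) (hne : a ≠ θ s) :
    ∫ x, 𝓐.contrast a (θ s) s x ∂μ < 0 := by
  refine lt_of_le_of_ne (h.integral_contrast_nonpos ha (hθ s)) fun h0 => ?_
  obtain ⟨c, hc⟩ := h.ae_tsum_eq_of_contrast ha (hθ s) (h.contrast_ae_eq_zero ha (hθ s) h0)
  exact h.not_ae_tsum_eq hθ hpos (ha.sub (hθ s)) (fun h' => hne (sub_eq_zero.1 h')) c hc

end IsAutoModelLaw

end AutoModelData

/-! ### Row norms in the space `M1` -/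

namespace M1

variable {S : Type*} [LinearOrder S]

lemma toMatrix_add (v w : M1 S) (s ℓ : S) :
    (v + w).toMatrix s ℓ = v.toMatrix s ℓ + w.toMatrix s ℓ := rfl

lemma toMatrix_sub (v w : M1 S) (s ℓ : S) :
    (v - w).toMatrix s ℓ = v.toMatrix s ℓ - w.toMatrix s ℓ := rfl

lemma toMatrix_of_le (v : M1 S) {s ℓ : S} (h : s ≤ ℓ) : v.toMatrix s ℓ = v ⟨(s, ℓ), h⟩ := by
  simp [toMatrix, h]

lemma toMatrix_comm (v : M1 S) (s ℓ : S) : v.toMatrix s ℓ = v.toMatrix ℓ s := by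
  simp [toMatrix, min_comm, max_comm]

lemma exists_toMatrix_ne_zero {v : M1 S} (hv : v ≠ 0) : ∃ s, v.toMatrix s ≠ 0 := by
  by_contra! h
  refine hv (lp.ext (funext fun p => ?_))
  rw [← toMatrix_of_le v p.2, h]
  rfl

lemma toMatrix_truncation (D : Finset S) {θ : S → S → ℝ} (hθ : ∀ s ℓ, θ s ℓ = θ ℓ s) (s ℓ : S) :
    (truncation D θ).toMatrix s ℓ = if s ∈ D ∧ ℓ ∈ D then θ s ℓ else 0 := by
  rcases le_total s ℓ with h | h
  · simp [toMatrix_of_le _ h, truncation]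
  · rw [toMatrix_comm, toMatrix_of_le _ h, hθ s ℓ]
    simp [truncation, and_comm]

lemma toMatrix_of_supportedOn {D : Finset S} {v : M1 S} (hv : v ∈ supportedOn D) {s ℓ : S}
    (hℓ : ℓ ∉ D) : v.toMatrix s ℓ = 0 := by
  rcases le_total s ℓ with h | h
  · rw [toMatrix_of_le _ h]
    exact hv _ fun h' => hℓ h'.2
  · rw [toMatrix_comm, toMatrix_of_le _ h]
    exact hv _ fun h' => hℓ h'.1

lemma truncation_mem_supportedOn (D : Finset S) (θ : S → S → ℝ) :
    truncation D θ ∈ supportedOn D := fun _ hp => if_neg hp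

lemma sub_mem_supportedOn {D : Finset S} {v w : M1 S} (hv : v ∈ supportedOn D)
    (hw : w ∈ supportedOn D) : v - w ∈ supportedOn D := fun p hp => by
  rw [lp.coeFn_sub, Pi.sub_apply, hv p hp, hw p hp, sub_zero]

/-- The absolute values of the entries at the ordered pairs, extended by zero. -/
noncomputable def orderedAbs (v : M1 S) (p : S × S) : ℝ :=
  if p.1 ≤ p.2 then |v.toMatrix p.1 p.2| else 0

lemma orderedAbs_nonneg (v : M1 S) (p : S × S) : 0 ≤ v.orderedAbs p := by
  unfold orderedAbs
  split_ifs
  exacts [abs_nonneg _, le_rfl]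

lemma hasSum_orderedAbs (v : M1 S) : HasSum v.orderedAbs ‖v‖ := by
  have h := lp.hasSum_norm (p := 1) (by simp) v
  simp only [ENNReal.toReal_one, Real.rpow_one] at h
  rw [← Subtype.val_injective.hasSum_iff (f := v.orderedAbs)
    (g := (Subtype.val : {p : S × S // p.1 ≤ p.2} → S × S))]
  · convert h using 2 with p
    simp [orderedAbs, p.2, toMatrix_of_le v p.2]
  · intro p hp
    have : ¬ p.1 ≤ p.2 := fun h => hp ⟨⟨p, h⟩, rfl⟩
    simp [orderedAbs, this]

lemma hasSum_orderedAbs_add_swap (v : M1 S) :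
    HasSum (fun p => v.orderedAbs p + v.orderedAbs p.swap) (2 * ‖v‖) := by
  rw [two_mul]
  exact v.hasSum_orderedAbs.add ((Equiv.prodComm S S).hasSum_iff.2 v.hasSum_orderedAbs)

lemma abs_toMatrix_le (v : M1 S) (p : S × S) :
    |v.toMatrix p.1 p.2| ≤ v.orderedAbs p + v.orderedAbs p.swap := by
  rcases le_total p.1 p.2 with h | h
  · have := v.orderedAbs_nonneg p.swap
    rw [show v.orderedAbs p = |v.toMatrix p.1 p.2| from if_pos h]
    linarith
  · have := v.orderedAbs_nonneg p
    rw [show v.orderedAbs p.swap = |v.toMatrix p.2 p.1| from if_pos h, v.toMatrix_comm p.2]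
    linarith

lemma summable_abs_toMatrix (v : M1 S) : Summable fun p : S × S => |v.toMatrix p.1 p.2| :=
  Summable.of_nonneg_of_le (fun _ => abs_nonneg _) v.abs_toMatrix_le
    v.hasSum_orderedAbs_add_swap.summable

lemma summable_toMatrix (v : M1 S) (s : S) : Summable (v.toMatrix s) :=
  summable_abs_iff.1 (v.summable_abs_toMatrix.prod_factor s)

/-- The `ℓ¹` norm of the row of index `s`. -/
noncomputable def rowNorm (v : M1 S) (s : S) : ℝ := ∑' ℓ, |v.toMatrix s ℓ|

lemma rowNorm_nonneg (v : M1 S) (s : S) : 0 ≤ v.rowNorm s := tsum_nonneg fun _ => abs_nonneg _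

lemma summable_rowNorm (v : M1 S) : Summable v.rowNorm := v.summable_abs_toMatrix.prod

/-- The factor 2 arises because an off-diagonal entry appears in two rows but is counted once in the
norm. -/
lemma sum_rowNorm_le (v : M1 S) (T : Finset S) : ∑ s ∈ T, v.rowNorm s ≤ 2 * ‖v‖ := by
  refine (v.summable_rowNorm.sum_le_tsum T fun s _ => v.rowNorm_nonneg s).trans ?_
  unfold rowNorm
  rw [← v.summable_abs_toMatrix.tsum_prod, ← v.hasSum_orderedAbs_add_swap.tsum_eq]
  exact v.summable_abs_toMatrix.tsum_le_tsum v.abs_toMatrix_le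
    v.hasSum_orderedAbs_add_swap.summable

lemma rowNorm_le_add_sub (v w : M1 S) (s : S) : v.rowNorm s ≤ w.rowNorm s + (v - w).rowNorm s := by
  have hw := (w.summable_toMatrix s).abs
  have hvw := ((v - w).summable_toMatrix s).abs
  unfold rowNorm
  rw [← hw.tsum_add hvw]
  refine (v.summable_toMatrix s).abs.tsum_le_tsum (fun ℓ => ?_) (hw.add hvw)
  rw [toMatrix_sub]
  have := abs_add_le (w.toMatrix s ℓ) (v.toMatrix s ℓ - w.toMatrix s ℓ)
  rwa [add_sub_cancel] at this

end M1

/-! ### Control of the penalty -/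

namespace IsPenaltyFamily

/-- This is the mean value theorem; right-continuity at 0 covers intervals starting at 0. -/
lemma exists_lipschitz {q : ℝ → ℝ → ℝ} (hq : IsPenaltyFamily q) :
    ∃ C : ℝ, 0 ≤ C ∧ ∀ lam, 0 < lam → ∀ x, 0 ≤ x → ∀ y, 0 ≤ y →
      |q lam x - q lam y| ≤ C * lam * |x - y| := by
  obtain ⟨C, hC⟩ := hq.deriv_bound
  refine ⟨|C|, abs_nonneg _, fun lam hlam => ?_⟩
  have key : ∀ x y, 0 ≤ x → x < y → |q lam y - q lam x| ≤ |C| * lam * |y - x| := by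
    intro x y hx hxy
    have hd : DifferentiableOn ℝ (q lam) (Set.Ioo x y) :=
      (hq.diff lam hlam.le).mono fun z hz => hx.trans_lt hz.1
    have hc : ContinuousOn (q lam) (Set.Icc x y) := by
      intro z hz
      rcases (hx.trans hz.1).eq_or_lt with h0 | h0
      · rw [← h0]
        exact (hq.rightCont lam hlam.le).mono fun w hw => hx.trans hw.1
      · exact ((hq.diff lam hlam.le).differentiableAt
          (isOpen_Ioi.mem_nhds h0)).continuousAt.continuousWithinAt
    obtain ⟨z, hz, hzeq⟩ := exists_deriv_eq_slope (q lam) hxy hc hd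
    have hyx : 0 < y - x := sub_pos.2 hxy
    rw [eq_div_iff hyx.ne'] at hzeq
    rw [← hzeq, abs_mul]
    refine mul_le_mul_of_nonneg_right ?_ (abs_nonneg _)
    have := hC lam hlam z (hx.trans_lt hz.1)
    rw [div_le_iff₀ hlam] at this
    exact this.trans (mul_le_mul_of_nonneg_right (le_abs_self C) hlam.le)
  intro x hx y hy
  rcases lt_trichotomy x y with h | h | h
  · rw [abs_sub_comm, abs_sub_comm x]
    exact key x y hx h
  · simp [h]
  · exact key y x hy h

end IsPenaltyFamily

namespace M1

variable {S : Type*} [LinearOrder S]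

/-- The sum runs over ordered pairs, exactly those counted by the norm, so the bound does not depend
on the size of `D`. -/
lemma abs_sum_penalty_sub_le {pen : ℝ → ℝ} {C : ℝ} (hC : 0 ≤ C)
    (hpen : ∀ x, 0 ≤ x → ∀ y, 0 ≤ y → |pen x - pen y| ≤ C * |x - y|) (D : Finset S)
    (θ v : M1 S) :
    |(∑ p ∈ (D ×ˢ D).filter (fun p => p.1 ≤ p.2), pen |(θ + v).toMatrix p.1 p.2|)
      - (∑ p ∈ (D ×ˢ D).filter (fun p => p.1 ≤ p.2), pen |θ.toMatrix p.1 p.2|)| ≤ C * ‖v‖ := by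
  rw [← Finset.sum_sub_distrib]
  calc _ ≤ ∑ p ∈ (D ×ˢ D).filter (fun p => p.1 ≤ p.2), C * v.orderedAbs p := by
        refine (Finset.abs_sum_le_sum_abs _ _).trans (Finset.sum_le_sum fun p hp => ?_)
        refine (hpen _ (abs_nonneg _) _ (abs_nonneg _)).trans (mul_le_mul_of_nonneg_left ?_ hC)
        rw [orderedAbs, if_pos (Finset.mem_filter.1 hp).2]
        refine (abs_abs_sub_abs_le_abs_sub _ _).trans_eq ?_
        rw [toMatrix_add, add_sub_cancel_left]
    _ ≤ C * ‖v‖ := by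
        rw [← Finset.mul_sum]
        exact mul_le_mul_of_nonneg_left
          (sum_le_hasSum _ (fun p _ => v.orderedAbs_nonneg p) v.hasSum_orderedAbs) hC

end M1

/-! ### Deterministic comparison of penalized pseudo-likelihoods -/

namespace AutoModelData

variable {E : Type*} [MeasurableSpace E] (𝓐 : AutoModelData E) {S : Type*} [LinearOrder S]
  [Countable S] [NeZero 𝓐.ρ] {θ : S → S → ℝ}

/-- The log-pseudo-likelihood ratio at a node `s` is controlled by the `s`-th row of the
perturbation. -/
lemma log_condDensity_add_sub_le (D : Finset S) (t v : M1 S) {s : S} (hs : s ∈ D) (x : S → E) :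
    Real.log (𝓐.condDensity (t + v).toMatrix D s x (x s))
      - Real.log (𝓐.condDensity t.toMatrix D s x (x s)) ≤ 2 * 𝓐.boundB * v.rowNorm s := by
  have hsum : ∀ w : M1 S, Summable ((D : Set S).indicator (w.toMatrix s)) := fun w =>
    (w.summable_toMatrix s).indicator _
  rw [𝓐.condDensity_eq_rowDensity (Finset.mem_coe.2 hs) (hsum _),
    𝓐.condDensity_eq_rowDensity (Finset.mem_coe.2 hs) (hsum _)]
  refine (le_abs_self _).trans ((𝓐.abs_log_rowDensity_sub_le (hsum _) (hsum _) s x (x s)).trans ?_)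
  refine mul_le_mul_of_nonneg_left ?_ (mul_nonneg zero_le_two 𝓐.boundB_nonneg)
  refine ((hsum _).sub (hsum _)).abs.tsum_le_tsum (fun ℓ => ?_) (v.summable_toMatrix s).abs
  by_cases hℓ : ℓ ∈ D
  · simp [hℓ, M1.toMatrix_add]
  · simp [hℓ]

/-- At a node whose neighbourhood lies in `D`, the log-pseudo-likelihood ratio is a contrast of full
conditional densities. -/
lemma log_condDensity_truncation_sub_le (hsymm : ∀ s ℓ, θ s ℓ = θ ℓ s) {D : Finset S} {s : S}
    (hs : s ∈ D) (hθ : Summable (θ s)) (hnb : ∀ ℓ, ℓ ∉ D → θ s ℓ = 0) (v : M1 S) {w : M1 S}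
    (hw : w ∈ M1.supportedOn D) (x : S → E) :
    Real.log (𝓐.condDensity (M1.truncation D θ + w).toMatrix D s x (x s))
      - Real.log (𝓐.condDensity (M1.truncation D θ).toMatrix D s x (x s))
      ≤ 𝓐.contrast (θ s + v.toMatrix s) (θ s) s x + 2 * 𝓐.boundB * (w - v).rowNorm s := by
  have hsum : ∀ w : M1 S, Summable ((D : Set S).indicator (w.toMatrix s)) := fun w =>
    (w.summable_toMatrix s).indicator _
  have h1 : (D : Set S).indicator ((M1.truncation D θ).toMatrix s) = θ s := by
    ext ℓ
    by_cases hℓ : ℓ ∈ D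
    · simp [hℓ, M1.toMatrix_truncation D hsymm, hs]
    · simp [hℓ, hnb ℓ hℓ]
  have h2 : (D : Set S).indicator ((M1.truncation D θ + w).toMatrix s) = θ s + w.toMatrix s := by
    ext ℓ
    by_cases hℓ : ℓ ∈ D
    · simp [hℓ, M1.toMatrix_add, M1.toMatrix_truncation D hsymm, hs]
    · simp [hℓ, hnb ℓ hℓ, M1.toMatrix_of_supportedOn hw hℓ]
  rw [𝓐.condDensity_eq_rowDensity (Finset.mem_coe.2 hs) (hsum _),
    𝓐.condDensity_eq_rowDensity (Finset.mem_coe.2 hs) (hsum _), h1, h2]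
  have h3 := (abs_le.1 (𝓐.abs_log_rowDensity_sub_le (hθ.add (w.summable_toMatrix s))
    (hθ.add (v.summable_toMatrix s)) s x (x s))).2
  have h4 : ∑' ℓ, |(θ s ℓ + w.toMatrix s ℓ) - (θ s ℓ + v.toMatrix s ℓ)| = (w - v).rowNorm s := by
    refine tsum_congr fun ℓ => ?_
    rw [M1.toMatrix_sub, add_sub_add_left_eq_sub]
  rw [h4] at h3
  simp only [contrast]
  change _ ≤ Real.log (𝓐.rowDensity (fun ℓ => θ s ℓ + v.toMatrix s ℓ) s x (x s)) - _ + _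
  change Real.log (𝓐.rowDensity (fun ℓ => θ s ℓ + w.toMatrix s ℓ) s x (x s)) - _ ≤ _
  linarith

/-- Local comparison of the penalized pseudo-likelihood at a perturbation `w` close to `v` with its
value at the truncated true network. -/
lemma penPseudoLik_sub_le (hsymm : ∀ s ℓ, θ s ℓ = θ ℓ s) (hθ : ∀ s, Summable (θ s))
    {D T : Finset S} (hTD : T ⊆ D) (hnb : ∀ s ∈ T, ∀ ℓ, ℓ ∉ D → θ s ℓ = 0) {pen : ℝ → ℝ} {C : ℝ}
    (hC : 0 ≤ C) (hpen : ∀ x, 0 ≤ x → ∀ y, 0 ≤ y → |pen x - pen y| ≤ C * |x - y|) (v : M1 S)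
    {w : M1 S} (hw : w ∈ M1.supportedOn D) {η : ℝ} (hη : ∑ s ∈ D \ T, v.rowNorm s ≤ η)
    (n : ℕ) (x : ℕ → S → E) :
    𝓐.penPseudoLik D pen n x (M1.truncation D θ + w).toMatrix
      - 𝓐.penPseudoLik D pen n x (M1.truncation D θ).toMatrix
      ≤ (∑ i ∈ Finset.range n, ∑ s ∈ T, 𝓐.contrast (θ s + v.toMatrix s) (θ s) s (x i))
        + n * (2 * 𝓐.boundB * (η + 2 * ‖w - v‖)) + C * ‖w‖ := by
  have hp := (abs_le.1 (M1.abs_sum_penalty_sub_le hC hpen D (M1.truncation D θ) w)).1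
  have hB : 0 ≤ 2 * 𝓐.boundB := mul_nonneg zero_le_two 𝓐.boundB_nonneg
  have hlik : ∀ i, ∑ s ∈ D,
        Real.log (𝓐.condDensity (M1.truncation D θ + w).toMatrix D s (x i) (x i s))
      - ∑ s ∈ D, Real.log (𝓐.condDensity (M1.truncation D θ).toMatrix D s (x i) (x i s))
      ≤ (∑ s ∈ T, 𝓐.contrast (θ s + v.toMatrix s) (θ s) s (x i))
        + 2 * 𝓐.boundB * (η + 2 * ‖w - v‖) := by
    intro i
    rw [← Finset.sum_sub_distrib, ← Finset.sum_sdiff hTD]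
    -- Off `T` the neighbourhood may leave `D`. Both networks are truncated there, so only the
    -- Lipschitz bound in the perturbation is needed.
    have h1 := Finset.sum_le_sum fun s (hs : s ∈ D \ T) =>
      (𝓐.log_condDensity_add_sub_le D (M1.truncation D θ) w (Finset.mem_sdiff.1 hs).1 (x i)).trans
        (mul_le_mul_of_nonneg_left (w.rowNorm_le_add_sub v s) hB)
    have h2 := Finset.sum_le_sum fun s (hs : s ∈ T) =>
      𝓐.log_condDensity_truncation_sub_le hsymm (hTD hs) (hθ s) (hnb s hs) v hw (x i)
    refine (add_le_add h1 h2).trans ?_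
    rw [← Finset.mul_sum, Finset.sum_add_distrib, Finset.sum_add_distrib, ← Finset.mul_sum]
    have h3 := (w - v).sum_rowNorm_le D
    rw [← Finset.sum_sdiff hTD] at h3
    have h4 : 2 * 𝓐.boundB * (∑ s ∈ D \ T, v.rowNorm s + ∑ s ∈ D \ T, (w - v).rowNorm s
        + ∑ s ∈ T, (w - v).rowNorm s) ≤ 2 * 𝓐.boundB * (η + 2 * ‖w - v‖) :=
      mul_le_mul_of_nonneg_left (by linarith) hB
    linarith
  have hsum := Finset.sum_le_sum fun i (_ : i ∈ Finset.range n) => hlik i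
  rw [Finset.sum_sub_distrib, Finset.sum_add_distrib, Finset.sum_const, Finset.card_range,
    nsmul_eq_mul] at hsum
  unfold penPseudoLik
  linarith

end AutoModelData

/-! ### Limit arguments: law of large numbers, local separation, tightness -/

lemma ae_tendsto_average_comp {Ω Y : Type*} [MeasurableSpace Ω] [MeasurableSpace Y]
    {P : Measure Ω} {ξ : ℕ → Ω → Y} {μ : Measure Y} (hξ : ∀ i, Measurable (ξ i))
    (hind : iIndepFun ξ P) (hlaw : ∀ i, P.map (ξ i) = μ) {g : Y → ℝ} (hg : Measurable g)
    (hgi : Integrable g μ) :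
    ∀ᵐ ω ∂P, Tendsto (fun n : ℕ => (∑ i ∈ Finset.range n, g (ξ i ω)) / n) atTop
      (𝓝 (∫ y, g y ∂μ)) := by
  have h := strong_law_ae_real (μ := P) (fun i ω => g (ξ i ω))
    (by rw [← hlaw 0] at hgi; exact hgi.comp_measurable (hξ 0))
    (fun i j hij => (hind.indepFun hij).comp hg hg)
    (fun i => IdentDistrib.comp (f := ξ i) (g := ξ 0) ⟨(hξ i).aemeasurable, (hξ 0).aemeasurable,
      by rw [hlaw, hlaw]⟩ hg)
  rwa [← integral_map (hξ 0).aemeasurable hg.aestronglyMeasurable, hlaw 0] at h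

namespace AutoModelData

variable {E : Type*} [MeasurableSpace E] {𝓐 : AutoModelData E} {S : Type*} [LinearOrder S]
  [Countable S] [Infinite S]

/-- Almost surely, all perturbations close to a fixed nonzero `v` are eventually worse than the
truncated true network. -/
lemma exists_ball_penPseudoLik_lt {D : ℕ → Finset S} (hD : Monotone D)
    (hDS : ∀ s, ∃ n, s ∈ D n) {q : ℝ → ℝ → ℝ} (hq : IsPenaltyFamily q) {lam : ℕ → ℝ}
    (hlam : ∀ n, 1 ≤ n → 0 < lam n) (hlamn : Tendsto (fun n : ℕ => lam n / n) atTop (𝓝 0))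
    {θ : S → S → ℝ} (hsymm : ∀ s ℓ, θ s ℓ = θ ℓ s) (hfin : ∀ s, {ℓ | ℓ ≠ s ∧ θ s ℓ ≠ 0}.Finite)
    {μ : Measure (S → E)} (hμ : 𝓐.IsAutoModelLaw θ μ)
    (hpos : ∀ s, (𝓐.condCovMatrix θ s μ).PosDef)
    {Ω : Type*} [MeasurableSpace Ω] {P : Measure Ω} {ξ : ℕ → Ω → S → E}
    (hξ : ∀ i, Measurable (ξ i)) (hind : iIndepFun ξ P) (hlaw : ∀ i, P.map (ξ i) = μ)
    {v : M1 S} (hv : v ≠ 0) :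
    ∃ r > 0, ∀ᵐ ω ∂P, ∀ᶠ n in atTop, ∀ w ∈ Metric.ball v r, w ∈ M1.supportedOn (D n) →
      𝓐.penPseudoLik (D n) (q (lam n)) n (fun i => ξ i ω) (M1.truncation (D n) θ + w).toMatrix
        < 𝓐.penPseudoLik (D n) (q (lam n)) n (fun i => ξ i ω)
          (M1.truncation (D n) θ).toMatrix := by
  have := hμ.1
  have hρ : NeZero 𝓐.ρ := hμ.neZero
  have hsupp : ∀ s, {ℓ | θ s ℓ ≠ 0}.Finite := fun s =>
    ((hfin s).insert s).subset fun ℓ hℓ => by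
      by_cases h : ℓ = s
      · exact Or.inl h
      · exact Or.inr ⟨h, hℓ⟩
  have hθ : ∀ s, Summable (θ s) := fun s => summable_of_hasFiniteSupport (hsupp s)
  have ha : ∀ s, Summable (θ s + v.toMatrix s) := fun s => (hθ s).add (v.summable_toMatrix s)
  obtain ⟨s₀, hs₀⟩ := M1.exists_toMatrix_ne_zero hv
  set δ : ℝ := -∫ x, 𝓐.contrast (θ s₀ + v.toMatrix s₀) (θ s₀) s₀ x ∂μ with hδdef
  have hδ : 0 < δ := neg_pos.2 <|
    hμ.integral_contrast_neg hθ (hpos s₀) (ha s₀) fun h => hs₀ (by simpa using h)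
  have hB := 𝓐.boundB_nonneg
  -- Budget per observation: the contrast is below `-3δ/4`, the tail and the radius cost at most `6
  -- * boundB * η ≤ 3δ/8`, and the penalty costs less than `δ/4`. The total is below `-δ/8`. The `+
  -- 1` avoids dividing by zero.
  set η : ℝ := δ / (16 * (𝓐.boundB + 1)) with hηdef
  have hη : 0 < η := by positivity
  have hBη : 𝓐.boundB * η ≤ δ / 16 := by
    rw [hηdef, ← mul_div_assoc, div_le_div_iff₀ (by positivity) (by positivity)]
    nlinarith
  obtain ⟨T₀, hT₀⟩ := summable_iff_vanishing_norm.1 v.summable_rowNorm η hη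
  -- `s₀` supplies the strict drift `-δ`; the other nodes of `T` contribute nonpositive
  -- expectations.
  set T : Finset S := insert s₀ T₀ with hTdef
  set g : (S → E) → ℝ := fun x => ∑ s ∈ T, 𝓐.contrast (θ s + v.toMatrix s) (θ s) s x with hgdef
  have hgm : Measurable g :=
    Finset.measurable_fun_sum _ fun s _ => 𝓐.measurable_contrast (ha s) (hθ s) s
  have hci : ∀ s, Integrable (𝓐.contrast (θ s + v.toMatrix s) (θ s) s) μ := fun s =>
    𝓐.integrable_contrast (ha s) (hθ s) s μ
  have hgi : Integrable g μ := integrable_finsetSum _ fun s _ => hci s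
  have hg : ∫ x, g x ∂μ ≤ -δ := by
    rw [hgdef, integral_finsetSum _ fun s _ => hci s, ← Finset.add_sum_erase _ _
      (Finset.mem_insert_self s₀ T₀), hδdef, neg_neg]
    have := Finset.sum_nonpos fun s (_ : s ∈ T.erase s₀) =>
      hμ.integral_contrast_nonpos (ha s) (hθ s)
    linarith
  obtain ⟨C, hC, hlip⟩ := hq.exists_lipschitz
  have hDlarge : ∀ s, ∀ᶠ n in atTop, s ∈ D n := fun s => by
    obtain ⟨N, hN⟩ := hDS s
    exact eventually_atTop.2 ⟨N, fun n hn => hD hn hN⟩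
  have hTlarge : ∀ᶠ n in atTop, T ⊆ D n ∧ ∀ s ∈ T, ∀ ℓ, ℓ ∉ D n → θ s ℓ = 0 := by
    refine Filter.Eventually.and ((Filter.eventually_all_finset T).2 fun s _ => hDlarge s)
      ((Filter.eventually_all_finset T).2 fun s _ => ?_)
    filter_upwards [(Filter.eventually_all_finite (hsupp s)).2 fun ℓ _ => hDlarge ℓ] with n hn ℓ hℓ
    by_contra h
    exact hℓ (hn ℓ h)
  have hpen : ∀ᶠ n : ℕ in atTop, C * (lam n / n) * (‖v‖ + η) < δ / 4 := by
    have : Tendsto (fun n : ℕ => C * (lam n / n) * (‖v‖ + η)) atTop (𝓝 (C * 0 * (‖v‖ + η))) :=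
      (hlamn.const_mul C).mul_const _
    rw [mul_zero, zero_mul] at this
    exact this.eventually (gt_mem_nhds (by positivity))
  refine ⟨η, hη, ?_⟩
  filter_upwards [ae_tendsto_average_comp hξ hind hlaw hgm hgi] with ω hω
  filter_upwards [hω.eventually (gt_mem_nhds (show ∫ x, g x ∂μ < -(3 / 4 * δ) by linarith)),
    hTlarge, hpen, eventually_ge_atTop 1] with n hn1 hn2 hn3 hn w hw hwD
  have hnpos : (0 : ℝ) < n := by exact_mod_cast hn
  have hwv : ‖w - v‖ < η := by rwa [mem_ball_iff_norm] at hw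
  have hwn : ‖w‖ ≤ ‖v‖ + η := by
    have := norm_add_le v (w - v)
    rw [add_sub_cancel] at this
    linarith
  have htail : ∑ s ∈ D n \ T, v.rowNorm s ≤ η := by
    refine (le_abs_self _).trans (hT₀ _ ?_).le
    exact Finset.disjoint_of_subset_right (Finset.subset_insert _ _) Finset.sdiff_disjoint
  have hmain := 𝓐.penPseudoLik_sub_le hsymm hθ hn2.1 hn2.2
    (mul_nonneg hC (hlam n hn).le) (hlip (lam n) (hlam n hn)) v hwD htail n fun i => ξ i ω
  rw [div_lt_iff₀ hnpos] at hn1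
  have hn3' : C * lam n * (‖v‖ + η) < δ / 4 * n := by
    have := mul_lt_mul_of_pos_right hn3 hnpos
    calc C * lam n * (‖v‖ + η) = C * (lam n / n) * (‖v‖ + η) * n := by field_simp
      _ < _ := this
  have h1 : C * lam n * ‖w‖ ≤ C * lam n * (‖v‖ + η) :=
    mul_le_mul_of_nonneg_left hwn (mul_nonneg hC (hlam n hn).le)
  have h2 : 2 * 𝓐.boundB * (η + 2 * ‖w - v‖) ≤ 3 / 8 * δ := by
    have : 𝓐.boundB * ‖w - v‖ ≤ 𝓐.boundB * η := mul_le_mul_of_nonneg_left hwv.le hB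
    linarith
  have h3 := mul_le_mul_of_nonneg_left h2 hnpos.le
  have h4 : 0 < (n : ℝ) * δ := by positivity
  change _ ≤ (∑ i ∈ Finset.range n, g (ξ i ω)) + _ + _ at hmain
  linarith

end AutoModelData

/-- Tightness reduces the claim to a compact set of vectors of norm at least `ε`. Finitely many of
the avoided balls cover it, so the null sets attached to individual `v` cause no trouble. Almost
sure eventual avoidance then gives probabilities tending to 0. -/
lemma tendstoInMeasure_norm_of_isTightMeasureSet {Ω F : Type*} [MeasurableSpace Ω]
    {P : Measure Ω} [IsFiniteMeasure P] [NormedAddCommGroup F] [MeasurableSpace F] [BorelSpace F]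
    {Y : ℕ → Ω → F} (hY : ∀ n, 1 ≤ n → Measurable (Y n))
    (htight : IsTightMeasureSet ((fun n => P.map (Y n)) '' Set.Ici 1))
    (hloc : ∀ v : F, v ≠ 0 → ∃ r > 0, ∀ᵐ ω ∂P, ∀ᶠ n in atTop, Y n ω ∉ Metric.ball v r) :
    TendstoInMeasure P (fun n ω => ‖Y n ω‖) atTop (fun _ => 0) := by
  rw [tendstoInMeasure_iff_norm]
  intro ε hε
  rw [ENNReal.tendsto_nhds_zero]
  intro δ hδ
  obtain ⟨K, hK, hKδ⟩ := isTightMeasureSet_iff_exists_isCompact_measure_compl_le.1 htight (δ / 2)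
    (ENNReal.half_pos hδ.ne')
  set K' : Set F := K ∩ {v | ε ≤ ‖v‖} with hK'def
  have hK' : IsCompact K' := hK.inter_right (isClosed_le continuous_const continuous_norm)
  have hK'0 : ∀ v ∈ K', v ≠ 0 := by
    rintro v hv rfl
    have : ε ≤ ‖(0 : F)‖ := hv.2
    rw [norm_zero] at this
    linarith
  choose! r hr hloc using hloc
  obtain ⟨t, ht, hcov⟩ := hK'.elim_nhds_subcover (fun v => Metric.ball v (r v)) fun v hv =>
    Metric.ball_mem_nhds v (hr v (hK'0 v hv))
  have hout : ∀ᵐ ω ∂P, ∀ᶠ n in atTop, Y n ω ∉ K' := by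
    have h1 : ∀ᵐ ω ∂P, ∀ v ∈ t, ∀ᶠ n in atTop, Y n ω ∉ Metric.ball v (r v) :=
      (Filter.eventually_all_finset t).2 fun v hv => hloc v (hK'0 v (ht v hv))
    filter_upwards [h1] with ω hω
    filter_upwards [(Filter.eventually_all_finset t).2 hω] with n hn hmem
    obtain ⟨v, hvt, hv⟩ := Set.mem_iUnion₂.1 (hcov hmem)
    exact hn v hvt hv
  -- The guard `1 ≤ n` makes the event empty at `n = 0`, where `Y` need not be measurable.
  have hlim : Tendsto (fun n => P {ω | 1 ≤ n ∧ Y n ω ∈ K'}) atTop (𝓝 (P ∅)) := by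
    refine tendsto_measure_of_ae_tendsto_indicator_of_isFiniteMeasure atTop MeasurableSet.empty
      (fun n => ?_) ?_
    · by_cases hn : 1 ≤ n
      · simp only [hn, true_and]
        exact hY n hn hK'.measurableSet
      · simp [hn]
    · filter_upwards [hout] with ω hω
      filter_upwards [hω] with n hn
      simp [hn]
  rw [measure_empty, ENNReal.tendsto_nhds_zero] at hlim
  filter_upwards [hlim (δ / 2) (ENNReal.half_pos hδ.ne'), eventually_ge_atTop 1] with n hn1 hn
  have hKn : P {ω | Y n ω ∈ Kᶜ} ≤ δ / 2 := by
    have := hKδ _ ⟨n, hn, rfl⟩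
    rwa [Measure.map_apply (hY n hn) hK.measurableSet.compl] at this
  calc P {ω | ε ≤ ‖‖Y n ω‖ - 0‖}
      ≤ P ({ω | Y n ω ∈ Kᶜ} ∪ {ω | 1 ≤ n ∧ Y n ω ∈ K'}) := by
        refine measure_mono fun ω hω => ?_
        by_cases h : Y n ω ∈ K
        · exact Or.inr ⟨hn, h, by simpa using hω⟩
        · exact Or.inl h
    _ ≤ δ / 2 + δ / 2 := (measure_union_le _ _).trans (add_le_add hKn hn1)
    _ = δ := ENNReal.add_halves δ

theorem corollary1
    {m : ℕ} (X : Set (EuclideanSpace ℝ (Fin m))) (hX : IsCompact X)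
    (𝓐 : AutoModelData X)
    {S : Type*} [LinearOrder S] [Countable S] [Infinite S]
    [MeasurableSpace (M1 S)] [BorelSpace (M1 S)]
    -- the increasing observation domains
    (D : ℕ → Finset S) (hD : Monotone D) (hDS : ∀ s, ∃ n, s ∈ D n)
    -- the penalty and its parameters
    (q : ℝ → ℝ → ℝ) (hq : IsPenaltyFamily q)
    (lam : ℕ → ℝ) (hlam : ∀ n, 1 ≤ n → 0 < lam n)
    (hlamn : Tendsto (fun n : ℕ => lam n / n) atTop (𝓝 0))
    -- the true network, with finite neighborhoods
    (θstar : S → S → ℝ) (hθstar : θstar ∈ NetworkMatrices S)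
    (hfin : ∀ s, {ℓ | ℓ ≠ s ∧ θstar s ℓ ≠ 0}.Finite)
    -- the i.i.d. infinite-volume random fields
    (μ : Measure (S → X)) (hμ : 𝓐.IsAutoModelLaw θstar μ)
    {Ω : Type*} [MeasurableSpace Ω] (P : Measure Ω) [IsProbabilityMeasure P]
    (ξ : ℕ → Ω → S → X) (hξ : ∀ i, Measurable (ξ i)) (hind : iIndepFun ξ P)
    (hlaw : ∀ i, P.map (ξ i) = μ)
    -- positive definiteness of the averaged conditional covariance matrices
    (hpos : ∀ θ ∈ NetworkMatrices S, ∀ s, (𝓐.condCovMatrix θ s μ).PosDef)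
    -- the penalized pseudo-likelihood estimators
    (θhat : ℕ → Ω → M1 S) (hmeas : ∀ n, 1 ≤ n → Measurable (θhat n))
    (hmax : ∀ n, 1 ≤ n → ∀ᵐ ω ∂P,
      θhat n ω ∈ 𝓐.argmaxPenPseudoLik (D n) (q (lam n)) n (fun i => ξ i ω))
    (htight : IsTightMeasureSet
      ((fun n => P.map fun ω => θhat n ω - M1.truncation (D n) θstar) '' Set.Ici 1)) :
    TendstoInMeasure P (fun n ω => ‖θhat n ω - M1.truncation (D n) θstar‖) atTop (fun _ => 0) := by
  refine tendstoInMeasure_norm_of_isTightMeasureSet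
    (fun n hn => (continuous_sub_right _).measurable.comp (hmeas n hn)) htight fun v hv => ?_
  obtain ⟨r, hr, hball⟩ := AutoModelData.exists_ball_penPseudoLik_lt hD hDS hq hlam hlamn
    hθstar.1 hfin hμ (hpos θstar hθstar) hξ hind hlaw hv
  refine ⟨r, hr, ?_⟩
  have hmax' : ∀ᵐ ω ∂P, ∀ n, 1 ≤ n →
      θhat n ω ∈ 𝓐.argmaxPenPseudoLik (D n) (q (lam n)) n (fun i => ξ i ω) := by
    refine ae_all_iff.2 fun n => ?_
    by_cases hn : 1 ≤ n
    · exact (hmax n hn).mono fun ω hω _ => hω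
    · exact Eventually.of_forall fun ω h => absurd h hn
  filter_upwards [hball, hmax'] with ω hω hωmax
  filter_upwards [hω, eventually_ge_atTop 1] with n hn hn1 hmem
  -- The truncated truth is an admissible competitor, so a maximizer cannot score strictly less.
  have htr := M1.truncation_mem_supportedOn (D n) θstar
  have hlt := hn _ hmem (M1.sub_mem_supportedOn (hωmax n hn1).1 htr)
  rw [add_sub_cancel] at hlt
  exact absurd ((hωmax n hn1).2 htr) (not_le.2 hlt)
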